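/- A numeration system is a strictly increasing sequence $U=(U_i)_{i\ge 0}$ of integers with $U_0=1$ such that $C_U:=\sup_{i\ge 0}\lceil U_{i+1}/U_i\rceil$ is finite; put $A_U=\{0,\dots,C_U-1\}$. The greedy $U$-representation of $n\ge 1$ is the unique word $\mathrm{rep}_U(n)=w_\ell\cdots w_0$ over $A_U$ with $w_\ell\ne 0$, $n=\sum_{i=0}^{\ell}w_iU_i$ and $\sum_{i=0}^{t}w_iU_i<U_{t+1}$ for $t=0,\dots,\ell$; $\mathrm{rep}_U(0)$ is the empty word. The set recognized by a DFA $\mathcal A$ over $A_U$ whose accepted language is contained in $\mathrm{rep}_U(\mathbb N)$ is $X_{\mathcal A}=\{n\in\mathbb N : \mathrm{rep}_U(n)\text{ is accepted by }\mathcal A\}$. A set $X\subseteq\mathbb N$ is ultimately periodic if there are $q\ge 1$ and $s\ge 0$ such that, for all $n\ge s$, $n\in X\iff n+q\in X$; the least such $q$ is its period $\pi_X$. Consider the numeration systems $U$ that ultimately satisfy a linear recurrence relation $U_{i+k}=a_{k-1}U_{i+k-1}+\cdots+a_0U_i$ for all $i\ge N$, with $k\ge 1$, $N\ge 0$, integers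 $a_0,\dots,a_{k-1}$ and $a_0\neq 0$, where $k$ is the least possible order of such a relation, and such that (H1) the language $\mathrm{rep}_U(\mathbb N)$ is regular; (H2) $\limsup_{i\to\infty}(U_{i+1}-U_i)=+\infty$; (H3) there is $G\ge 0$ such that $U_{i+1}-U_i\le U_{i+2}-U_{i+1}$ for all $i\ge G$; and $\gcd(a_0,\dots,a_{k-1})=1$. 1. It is decidable, given such a system $U$ and a DFA $\mathcal A$ over $A_U$ accepting a language contained in $\mathrm{rep}_U(\mathbb N)$, whether $X_{\mathcal A}$ is ultimately periodic. More precisely, there is one algorithm (a partial recursive function) which, given the coefficients $a_0,\dots,a_{k-1}$, the initial terms $U_0,\dots,U_{N+k-1}$, the tables of some DFA accepting $\mathrm{rep}_U(\mathbb N)$ and the tables of $\mathcal A$, always halts and answers correctly. (In particular, for each fixed $U$ the problem is decidable with $\mathcal A$ as the only input.) 2. For every such $U$ and every prime $p$ there is an integer $\lambda\ge 1$ depending only on $U$ and $p$, which equals $1$ if $p>\max\{|a_0|,U_N\}$, such that the following holds. If a DFA $\mathcal A$ with $m$ states accepts a language contained in $\mathrm{rep}_U(\mathbb N)$ and $X=X_{\mathcal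 A}$ is ultimately periodic with period $\pi_X$, then $p^{\mu-\lambda+1}\le m$ for every $\mu\ge\lambda$ such that $p^{\mu}$ divides $\pi_X$. -/

import Mathlib

open Filter

namespace NumerationSystem

/-- A numeration system: a strictly increasing sequence of integers with `U 0 = 1` and bounded
quotients `⌈U (i+1) / U i⌉`. -/
structure IsNumerationSystem (U : ℕ → ℕ) : Prop where
  strictMono : StrictMono U
  zero : U 0 = 1
  bounded : BddAbove (Set.range fun i => ⌈(U (i + 1) : ℚ) / (U i : ℚ)⌉₊)

/-- The number `C_U = sup_i ⌈U (i+1) / U i⌉`. The canonical alphabet `{0, …, C_U - 1}` is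
`Fin (alphabetSize U)`. -/
noncomputable def alphabetSize (U : ℕ → ℕ) : ℕ :=
  sSup (Set.range fun i => ⌈(U (i + 1) : ℚ) / (U i : ℚ)⌉₊)

/-- The `U`-numerical value of a word of digits, most significant digit first. -/
def val (U : ℕ → ℕ) : List ℕ → ℕ
  | [] => 0
  | d :: w => d * U w.length + val U w

/-- `w` (most significant digit first) is the greedy `U`-representation of `n`: it has value `n`,
no leading zero, and the value of each of its suffixes of length `t` is less than `U t`.
For `n = 0` the only such word is the empty one. -/
def IsGreedyRep (U : ℕ → ℕ) (n : ℕ) (w : List ℕ) : Prop :=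
  val U w = n ∧ w.head? ≠ some 0 ∧ ∀ v, v <:+ w → val U v < U v.length

/-- The language `rep_U(X)` over the canonical alphabet. -/
def repLanguage (U : ℕ → ℕ) (X : Set ℕ) : Language (Fin (alphabetSize U)) :=
  {w | ∃ n ∈ X, IsGreedyRep U n (w.map Fin.val)}

/-- The set of integers whose greedy `U`-representation belongs to the language `L`. -/
def recognizedSet (U : ℕ → ℕ) (L : Language (Fin (alphabetSize U))) : Set ℕ :=
  {n | ∃ w ∈ L, IsGreedyRep U n (w.map Fin.val)}

/-- The set of all natural numbers is `U`-recognizable. -/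
def H1 (U : ℕ → ℕ) : Prop :=
  (repLanguage U Set.univ).IsRegular

/-- The limit superior of the gaps `U (i+1) - U i` is infinite. -/
def H2 (U : ℕ → ℕ) : Prop :=
  ∀ K : ℤ, ∃ᶠ i in atTop, K ≤ (U (i + 1) : ℤ) - U i

/-- The sequence of gaps is ultimately non-decreasing. -/
def H3 (U : ℕ → ℕ) : Prop :=
  ∃ G : ℕ, ∀ i ≥ G, (U (i + 1) : ℤ) - U i ≤ (U (i + 2) : ℤ) - U (i + 1)

/-- For all `i ≥ N`, `U (i+k) = a (k-1) * U (i+k-1) + ⋯ + a 0 * U i`, where `k ≥ 1` and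
`a 0 ≠ 0`. -/
structure IsRecurrence (U : ℕ → ℕ) (k : ℕ) (a : Fin k → ℤ) (N : ℕ) : Prop where
  pos : 0 < k
  coeff_zero_ne : a ⟨0, pos⟩ ≠ 0
  relation : ∀ i ≥ N, (U (i + k) : ℤ) = ∑ j : Fin k, a j * U (i + j)

/-- A recurrence relation of least possible order satisfied by `U`. -/
structure IsMinimalRecurrence (U : ℕ → ℕ) (k : ℕ) (a : Fin k → ℤ) (N : ℕ) : Prop
    extends IsRecurrence U k a N where
  minimal : ∀ (k' : ℕ) (a' : Fin k' → ℤ) (N' : ℕ), IsRecurrence U k' a' N' → k ≤ k'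

/-- `p` is the length of a (not necessarily shortest) repetend `v` when the characteristic
sequence of `X` is written as `u v v v …`. -/
def IsUltimatePeriod (X : Set ℕ) (p : ℕ) : Prop :=
  0 < p ∧ ∃ s : ℕ, ∀ n ≥ s, (n ∈ X ↔ n + p ∈ X)

/-- `X` is ultimately periodic. -/
def UltimatelyPeriodic (X : Set ℕ) : Prop :=
  ∃ p, IsUltimatePeriod X p

/-- The period of an ultimately periodic set: the least length of a repetend. -/
noncomputable def period (X : Set ℕ) : ℕ :=
  sInf {p | IsUltimatePeriod X p}

/-- Finite data describing a linear recurrence sequence: the coefficients `a 0, …, a (k-1)` and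
the initial terms `U 0, …, U (N+k-1)`. -/
abbrev SequenceCode : Type := List ℤ × List ℕ

/-- The description of `U` by a recurrence relation and initial terms. -/
def encodeSequence (U : ℕ → ℕ) (k : ℕ) (a : Fin k → ℤ) (N : ℕ) : SequenceCode :=
  (List.ofFn a, List.ofFn fun i : Fin (N + k) => U i)

/-- Finite data describing a DFA: transition table (one row for each state), initial state, and the
table of final states. -/
abbrev DFACode : Type := List (List ℕ) × ℕ × List Bool

open Classical in
/-- The tables of a DFA with alphabet `{0, …, c-1}` and states `0, …, n-1`. -/
noncomputable def encodeDFA {c n : ℕ} (M : DFA (Fin c) (Fin n)) : DFACode :=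
  (List.ofFn fun q => List.ofFn fun d => (M.step q d : ℕ), (M.start : ℕ),
    List.ofFn fun q => decide (q ∈ M.accept))

end NumerationSystem

/-! The heart is a lower bound on the number of states (`pow_le_card_of_dvd_period`). Let X have
period q. Since the gaps of U tend to infinity, a word made of t widely spaced digits 1 is greedy
and stays greedy before every padded greedy block of a fixed length. If the ones sit at positions j
with U_j ≡ c mod q, its contribution is ≡ tc mod q. When two such words lead to the same state, the
difference of their contributions is an ultimate period of X, hence a multiple of q. If p^e divides
q and p^l does not divide c, with e ≥ l ≥ 1, then t matters modulo p^(e-l+1), so there are at least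
that many states.

A suitable c exists as soon as p^l fails to divide U_j for infinitely many j. Minimality of the
recurrence makes the Hankel determinant D nonzero (`det_hankel_ne_zero`). Solving the recurrence
backwards modulo p, which is possible because the coefficients have gcd 1, gives l = v_p(D) + 1
(`frequently_not_dvd`). For p above |a_0| and U_N, l = 1 works.

Consequently q divides m!·|D|, so X is ultimately periodic exactly when one explicit number Q is an
ultimate period. This is a finite check (`isUltimatePeriod_iff`): a product automaton tracks
membership in X and the value modulo Q, and pumping restricts the test to words of bounded length.
The check is primitive recursive in the tables. -/

namespace NumerationSystem

/-! ### Values of words and padded greedy words -/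

theorem val_append (U : ℕ → ℕ) (x y : List ℕ) :
    val U (x ++ y) = val (fun i => U (i + y.length)) x + val U y := by
  induction x with
  | nil => simp [val]
  | cons d x ih => simp [val, ih, add_assoc]

theorem val_replicate_zero (U : ℕ → ℕ) (n : ℕ) : val U (List.replicate n 0) = 0 := by
  induction n with
  | zero => rfl
  | succ n ih => simp [List.replicate_succ, val, ih]

/-- The value of each suffix of length `t` is less than `U t`: a greedy representation, possibly
padded with leading zeros. -/
def IsPaddedGreedy (U : ℕ → ℕ) (w : List ℕ) : Prop :=
  ∀ v, v <:+ w → val U v < U v.length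

theorem isPaddedGreedy_cons {U : ℕ → ℕ} {d : ℕ} {w : List ℕ} :
    IsPaddedGreedy U (d :: w) ↔
      d * U w.length + val U w < U (w.length + 1) ∧ IsPaddedGreedy U w := by
  constructor
  · exact fun h => ⟨h _ (List.suffix_refl _), fun v hv => h v (hv.trans (List.suffix_cons _ _))⟩
  · rintro ⟨h1, h2⟩ v hv
    rcases List.suffix_cons_iff.1 hv with rfl | hv
    · exact h1
    · exact h2 v hv

theorem IsPaddedGreedy.val_lt {U : ℕ → ℕ} {w : List ℕ} (h : IsPaddedGreedy U w) :
    val U w < U w.length :=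
  h w (List.suffix_refl _)

/-- The tail has value below the weight of the leading digit, so digit and tail value are the
quotient and remainder of a Euclidean division. -/
theorem IsPaddedGreedy.eq_of_val_eq {U : ℕ → ℕ} {w w' : List ℕ} :
    IsPaddedGreedy U w → IsPaddedGreedy U w' → w.length = w'.length → val U w = val U w' →
      w = w' := by
  induction w generalizing w' with
  | nil =>
    intro _ _ hl _
    exact (List.length_eq_zero_iff.1 hl.symm).symm
  | cons d w ih =>
    intro h h' hl hv
    cases w' with
    | nil => simp at hl
    | cons d' w' =>
      simp only [List.length_cons, add_left_inj] at hl
      have h1 := (isPaddedGreedy_cons.1 h).2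
      have h2 := (isPaddedGreedy_cons.1 h').2
      have h3 := h1.val_lt
      have h4 := h2.val_lt
      simp only [val] at hv
      rw [← hl] at hv h4
      have hd : d = d' := by
        have e1 : (d * U w.length + val U w) / U w.length = d := by
          rw [mul_comm, Nat.mul_add_div (by omega), Nat.div_eq_of_lt h3, add_zero]
        have e2 : (d' * U w.length + val U w') / U w.length = d' := by
          rw [mul_comm, Nat.mul_add_div (by omega), Nat.div_eq_of_lt h4, add_zero]
        rw [← e1, ← e2, hv]
      subst hd
      rw [ih h1 h2 hl (by omega)]

theorem le_val_of_head?_ne_zero {U : ℕ → ℕ} {w : List ℕ} (h : w.head? ≠ some 0)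
    (hw : w ≠ []) : U (w.length - 1) ≤ val U w := by
  cases w with
  | nil => exact absurd rfl hw
  | cons d w =>
    simp only [List.head?_cons, ne_eq, Option.some.injEq] at h
    simp only [List.length_cons, add_tsub_cancel_right, val]
    have : 1 * U w.length ≤ d * U w.length := Nat.mul_le_mul_right _ (by omega)
    omega

/-! ### Existence and uniqueness of greedy representations -/

namespace IsNumerationSystem

variable {U : ℕ → ℕ} (hU : IsNumerationSystem U)
include hU

theorem pos (i : ℕ) : 0 < U i := by
  have := hU.strictMono.monotone (Nat.zero_le i)
  rw [hU.zero] at this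
  omega

theorem lt_apply (i : ℕ) : i < U i := by
  induction i with
  | zero => exact hU.pos 0
  | succ i ih =>
    have := hU.strictMono (Nat.lt_succ_self i)
    simp only [Nat.succ_eq_add_one] at this
    omega

theorem le_alphabetSize_mul (i : ℕ) : U (i + 1) ≤ alphabetSize U * U i := by
  have h1 : ⌈(U (i + 1) : ℚ) / (U i : ℚ)⌉₊ ≤ alphabetSize U :=
    le_csSup hU.bounded ⟨i, rfl⟩
  have h2 : (U (i + 1) : ℚ) / (U i : ℚ) ≤ alphabetSize U :=
    (Nat.le_ceil _).trans (by exact_mod_cast h1)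
  have h3 : (0 : ℚ) < U i := by exact_mod_cast hU.pos i
  rw [div_le_iff₀ h3] at h2
  exact_mod_cast h2

theorem two_le_alphabetSize : 2 ≤ alphabetSize U := by
  have h1 := hU.le_alphabetSize_mul 0
  have h2 := hU.strictMono Nat.zero_lt_one
  rw [hU.zero] at h1 h2
  simp only [zero_add] at h1
  omega

theorem isPaddedGreedy_nil : IsPaddedGreedy U [] := by
  intro v hv
  rw [List.suffix_nil.1 hv]
  exact hU.pos 0

theorem isPaddedGreedy_replicate_append {w : List ℕ} (h : IsPaddedGreedy U w) (n : ℕ) :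
    IsPaddedGreedy U (List.replicate n 0 ++ w) := by
  induction n with
  | zero => simpa using h
  | succ n ih =>
    rw [List.replicate_succ, List.cons_append, isPaddedGreedy_cons]
    refine ⟨?_, ih⟩
    have := ih.val_lt
    have := hU.strictMono (Nat.lt_succ_self (List.replicate n 0 ++ w).length)
    simp only [Nat.succ_eq_add_one] at this
    omega

theorem exists_isPaddedGreedy (l : ℕ) : ∀ n < U l, ∃ w : List (Fin (alphabetSize U)),
    w.length = l ∧ IsPaddedGreedy U (w.map Fin.val) ∧ val U (w.map Fin.val) = n := by
  induction l with
  | zero =>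
    intro n hn
    rw [hU.zero] at hn
    exact ⟨[], rfl, hU.isPaddedGreedy_nil, by simp [val]; omega⟩
  | succ l ih =>
    intro n hn
    obtain ⟨w, hl, hw, hv⟩ := ih (n % U l) (Nat.mod_lt _ (hU.pos l))
    have hd : n / U l < alphabetSize U :=
      (Nat.div_lt_iff_lt_mul (hU.pos l)).2 (hn.trans_le (hU.le_alphabetSize_mul l))
    have hval : n / U l * U l + n % U l = n := by
      rw [mul_comm]
      exact Nat.div_add_mod n (U l)
    refine ⟨⟨n / U l, hd⟩ :: w, by simp [hl], ?_, ?_⟩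
    · rw [List.map_cons, isPaddedGreedy_cons, List.length_map, hl, hv, hval]
      exact ⟨hn, hw⟩
    · rw [List.map_cons, val, List.length_map, hl, hv, hval]

theorem exists_isGreedyRep (n : ℕ) :
    ∃ w : List (Fin (alphabetSize U)), IsGreedyRep U n (w.map Fin.val) := by
  have hex : ∃ l, n < U l := ⟨n, hU.lt_apply n⟩
  classical
  obtain ⟨w, hl, hw, hv⟩ := hU.exists_isPaddedGreedy _ n (Nat.find_spec hex)
  refine ⟨w, hv, ?_, hw⟩
  cases w with
  | nil => simp
  | cons d w =>
    intro h0
    simp only [List.map_cons, List.head?_cons, Option.some.injEq] at h0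
    rw [List.map_cons, h0] at hw hv
    have h1 := (isPaddedGreedy_cons.1 hw).2.val_lt
    simp only [val, zero_mul, zero_add] at hv
    rw [hv, List.length_map] at h1
    simp only [List.length_cons] at hl
    exact Nat.find_min hex (by omega) h1

theorem length_le_length_of_isGreedyRep {n : ℕ} {w w' : List ℕ} (h : IsGreedyRep U n w) (h' : IsGreedyRep U n w') :
    w.length ≤ w'.length := by
  by_contra! hlt
  have h1 := le_val_of_head?_ne_zero (U := U) h.2.1 (by rintro rfl; simp at hlt)
  have h2 := IsPaddedGreedy.val_lt h'.2.2
  rw [h.1] at h1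
  rw [h'.1] at h2
  have := hU.strictMono.monotone (show w'.length ≤ w.length - 1 by omega)
  omega

theorem isGreedyRep_unique {n : ℕ} {w w' : List ℕ} (h : IsGreedyRep U n w)
    (h' : IsGreedyRep U n w') : w = w' :=
  IsPaddedGreedy.eq_of_val_eq h.2.2 h'.2.2
    (le_antisymm (hU.length_le_length_of_isGreedyRep h h') (hU.length_le_length_of_isGreedyRep h' h)) (h.1.trans h'.1.symm)

theorem length_le_of_isGreedyRep {n : ℕ} {w : List ℕ} (h : IsGreedyRep U n w) : w.length ≤ n := by
  by_cases hw : w = []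
  · simp [hw]
  · have h1 := le_val_of_head?_ne_zero (U := U) h.2.1 hw
    have h2 := hU.lt_apply (w.length - 1)
    have := List.length_pos_iff.2 hw
    rw [h.1] at h1
    omega

theorem le_length_of_isGreedyRep {n l : ℕ} {w : List ℕ} (h : IsGreedyRep U n w) (hl : U l ≤ n) :
    l < w.length := by
  have h1 := IsPaddedGreedy.val_lt h.2.2
  rw [h.1] at h1
  exact hU.strictMono.lt_iff_lt.1 (hl.trans_lt h1)

theorem mem_recognizedSet_iff {n : ℕ} {w : List (Fin (alphabetSize U))}
    (h : IsGreedyRep U n (w.map Fin.val)) (L : Language (Fin (alphabetSize U))) :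
    n ∈ recognizedSet U L ↔ w ∈ L := by
  constructor
  · rintro ⟨w', hw', h'⟩
    have := List.map_injective_iff.2 Fin.val_injective (hU.isGreedyRep_unique h h')
    rwa [this]
  · exact fun hw => ⟨w, hw, h⟩

end IsNumerationSystem

/-! ### Large gaps and valuations -/

theorem exists_gap_gt {U : ℕ → ℕ} (h2 : H2 U) (h3 : H3 U) (n : ℕ) :
    ∃ i₀, ∀ i ≥ i₀, U i + n < U (i + 1) := by
  obtain ⟨G, hG⟩ := h3
  obtain ⟨i₀, hi₀, hK⟩ := (frequently_atTop.1 (h2 (n + 1))) G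
  refine ⟨i₀, fun i hi => ?_⟩
  have : (n + 1 : ℤ) ≤ (U (i + 1) : ℤ) - U i := by
    induction i, hi using Nat.le_induction with
    | base => exact hK
    | succ i hi ih => exact ih.trans (hG i (by omega))
  omega

theorem pow_succ_dvd_or_of_dvd_mul {p : ℕ} (hp : p.Prime) {u v a b : ℕ}
    (h : p ^ (u + v + 1) ∣ a * b) : p ^ (u + 1) ∣ a ∨ p ^ (v + 1) ∣ b := by
  obtain ⟨d₁, d₂, h1, h2, h12⟩ := exists_dvd_and_dvd_of_dvd_mul h
  obtain ⟨i, -, rfl⟩ := (Nat.dvd_prime_pow hp).1 (Dvd.intro _ h12.symm)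
  obtain ⟨j, -, rfl⟩ := (Nat.dvd_prime_pow hp).1 (Dvd.intro_left _ h12.symm)
  rw [← pow_add] at h12
  have := Nat.pow_right_injective hp.two_le h12
  by_cases hi : u + 1 ≤ i
  · exact Or.inl ((pow_dvd_pow p hi).trans h1)
  · exact Or.inr ((pow_dvd_pow p (by omega)).trans h2)

/-! ### Ultimate periods, and prime powers in the period against the number of states -/

section UltimatePeriod

variable {X : Set ℕ}

theorem UltimatelyPeriodic.isUltimatePeriod_period (h : UltimatelyPeriodic X) :
    IsUltimatePeriod X (period X) :=
  Nat.sInf_mem (s := {p | IsUltimatePeriod X p}) h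

theorem IsUltimatePeriod.mul {p : ℕ} (h : IsUltimatePeriod X p) :
    ∃ s, ∀ t, ∀ n ≥ s, (n ∈ X ↔ n + p * t ∈ X) := by
  obtain ⟨-, s, hs⟩ := h
  refine ⟨s, fun t => ?_⟩
  induction t with
  | zero => simp
  | succ t ih =>
    intro n hn
    rw [ih n hn, hs _ (by omega), mul_add, mul_one, add_assoc]

theorem IsUltimatePeriod.of_dvd {p q : ℕ} (h : IsUltimatePeriod X p) (hq : 0 < q) (hpq : p ∣ q) :
    IsUltimatePeriod X q := by
  obtain ⟨t, rfl⟩ := hpq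
  obtain ⟨s, hs⟩ := h.mul
  exact ⟨hq, s, hs t⟩

theorem IsUltimatePeriod.mem_iff_of_modEq {p : ℕ} (h : IsUltimatePeriod X p) :
    ∃ s, ∀ n ≥ s, ∀ n' ≥ s, n ≡ n' [MOD p] → (n ∈ X ↔ n' ∈ X) := by
  obtain ⟨s, hs⟩ := h.mul
  have key : ∀ n ≥ s, ∀ n' ≥ n, n ≡ n' [MOD p] → (n ∈ X ↔ n' ∈ X) := by
    intro n hn n' hn' hmod
    obtain ⟨t, ht⟩ := (Nat.modEq_iff_dvd' hn').1 hmod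
    rw [hs t n hn, ← ht, Nat.add_sub_cancel' hn']
  refine ⟨s, fun n hn n' hn' hmod => ?_⟩
  rcases le_total n n' with h | h
  · exact key n hn n' h hmod
  · exact (key n' hn' n h hmod.symm).symm

/-- A nonzero remainder of `d` modulo the least period would be a smaller ultimate period. -/
theorem period_dvd {d : ℕ} (h : IsUltimatePeriod X d) : period X ∣ d := by
  have hX : UltimatelyPeriodic X := ⟨d, h⟩
  have hp := hX.isUltimatePeriod_period
  obtain ⟨s, hs⟩ := hp.mul
  obtain ⟨-, s', hs'⟩ := h
  rw [Nat.dvd_iff_mod_eq_zero]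
  by_contra hne
  have hr : IsUltimatePeriod X (d % period X) := by
    refine ⟨Nat.pos_of_ne_zero hne, s + s', fun n hn => ?_⟩
    rw [hs' n (by omega), hs (d / period X) (n + d % period X) (by omega), add_assoc,
      Nat.mod_add_div]
  exact absurd (Nat.sInf_le (s := {p | IsUltimatePeriod X p}) hr)
    (not_le.2 (Nat.mod_lt _ hp.1))

end UltimatePeriod

/-- If the terms congruent to `c` modulo `q` recur, then every multiple of `c` is realised by a
greedy word which may be followed by every padded greedy word of a given length. -/
theorem exists_greedy_prefix {U : ℕ → ℕ} (hU : IsNumerationSystem U) (h2 : H2 U) (h3 : H3 U)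
    {q c : ℕ} (hc : ∃ᶠ j in atTop, U j ≡ c [MOD q]) (l t : ℕ) :
    ∃ x : List (Fin (alphabetSize U)), (t ≠ 0 → x ≠ []) ∧ ∃ n : ℕ, n ≡ t * c [MOD q] ∧
      ∀ y : List (Fin (alphabetSize U)), y.length = l → IsPaddedGreedy U (y.map Fin.val) →
        IsPaddedGreedy U ((x ++ y).map Fin.val) ∧
        (t ≠ 0 → ((x ++ y).map Fin.val).head? ≠ some 0) ∧
        val U ((x ++ y).map Fin.val) = n + val U (y.map Fin.val) := by
  have hc2 := hU.two_le_alphabetSize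
  induction t with
  | zero => exact ⟨[], by simp, 0, by simp [Nat.ModEq.refl], fun y _ hy => ⟨hy, by simp, by simp⟩⟩
  | succ t ih =>
    obtain ⟨x, -, n, hn, hx⟩ := ih
    -- `U (x.length + l)` bounds the value of `x ++ y` for every admissible `y`, so a new leading 1
    -- placed before a larger gap keeps the word greedy whatever `y` is.
    obtain ⟨i₀, hi₀⟩ := exists_gap_gt h2 h3 (U (x.length + l))
    obtain ⟨j, hj, hjc⟩ := frequently_atTop.1 hc (i₀ + (x.length + l))
    obtain ⟨r, rfl⟩ := Nat.exists_eq_add_of_le (show x.length + l ≤ j by omega)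
    refine ⟨⟨1, by omega⟩ :: (List.replicate r ⟨0, by omega⟩ ++ x), by simp,
      U (x.length + l + r) + n, ?_, ?_⟩
    · rw [add_mul, one_mul, add_comm]
      exact hn.add hjc
    · intro y hy hyg
      obtain ⟨hg, -, hv⟩ := hx y hy hyg
      have hlt := hg.val_lt
      have hlen : ((x ++ y).map Fin.val).length = x.length + l := by simp [hy]
      have heq : List.map Fin.val
          ((⟨1, by omega⟩ : Fin (alphabetSize U)) ::
            (List.replicate r ⟨0, by omega⟩ ++ x) ++ y) =
          1 :: (List.replicate r 0 ++ (x ++ y).map Fin.val) := by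
        simp
      have hlen' : (List.replicate r 0 ++ (x ++ y).map Fin.val).length = x.length + l + r := by
        rw [List.length_append, hlen, List.length_replicate, add_comm]
      have hval : val U (List.replicate r 0 ++ (x ++ y).map Fin.val) =
          val U ((x ++ y).map Fin.val) := by
        rw [val_append, val_replicate_zero, zero_add]
      rw [heq]
      refine ⟨?_, by simp, ?_⟩
      · rw [isPaddedGreedy_cons]
        refine ⟨?_, hU.isPaddedGreedy_replicate_append hg r⟩
        rw [hlen', hval, one_mul]
        have := hi₀ (x.length + l + r) (by omega)
        rw [hlen] at hlt
        omega
      · rw [val, hlen', hval, hv]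
        ring

/-- Prime powers dividing the period of a recognized set are bounded by the number of states. -/
theorem pow_le_card_of_dvd_period {U : ℕ → ℕ} (hU : IsNumerationSystem U) (h2 : H2 U) (h3 : H3 U)
    {p : ℕ} (hp : p.Prime) {l : ℕ} (hl : 1 ≤ l) (hfr : ∃ᶠ j in atTop, ¬ p ^ l ∣ U j)
    {m : ℕ} (A : DFA (Fin (alphabetSize U)) (Fin m))
    (hX : UltimatelyPeriodic (recognizedSet U A.accepts)) {e : ℕ} (he : l ≤ e)
    (hdvd : p ^ e ∣ period (recognizedSet U A.accepts)) : p ^ (e - l + 1) ≤ m := by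
  set X := recognizedSet U A.accepts with hXdef
  have hper := hX.isUltimatePeriod_period
  set q := period X with hq
  -- Pigeonhole on residues modulo `q`: since `p ^ l ∣ q`, divisibility by `p ^ l` depends only on
  -- the residue.
  obtain ⟨c, hc, hpc⟩ : ∃ c, (∃ᶠ j in atTop, U j ≡ c [MOD q]) ∧ ¬ p ^ l ∣ c := by
    by_contra! hcon
    have : ∀ᶠ j in atTop, ∀ c ∈ Finset.range q, ¬ p ^ l ∣ c → ¬ (U j ≡ c [MOD q]) := by
      rw [Filter.eventually_all_finset]
      intro c _
      by_cases h : p ^ l ∣ c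
      · simp [h]
      · have : ¬ ∃ᶠ j in atTop, U j ≡ c [MOD q] := fun hf => h (hcon c hf)
        rw [Filter.not_frequently] at this
        exact this.mono fun j hj _ => hj
    obtain ⟨j, hj1, hj2⟩ := (hfr.and_eventually this).exists
    refine hj2 (U j % q) (Finset.mem_range.2 (Nat.mod_lt _ hper.1)) ?_ (Nat.mod_modEq _ _).symm
    rwa [Nat.dvd_mod_iff ((pow_dvd_pow p he).trans hdvd)]
  obtain ⟨s, hs⟩ := hper.mem_iff_of_modEq
  -- Blocks of length `s + q` serve two ends: `U (s + q) ≥ q` lets them take every residue modulo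
  -- `q` as value, and their length pushes the whole number past the threshold `s`.
  have hsl : s + q ≤ U (s + q) := (hU.lt_apply _).le
  choose x hx0 n hn hx using exists_greedy_prefix hU h2 h3 hc (s + q)
  have hrep : ∀ t, t ≠ 0 → ∀ r < q, ∀ y : List (Fin (alphabetSize U)), y.length = s + q →
      IsPaddedGreedy U (y.map Fin.val) → val U (y.map Fin.val) = r →
      (n t + r ∈ X ↔ x t ++ y ∈ A.accepts) ∧ s ≤ n t + r := by
    intro t ht r hr y hy hyg hyv
    obtain ⟨hg, hh, hv⟩ := hx t y hy hyg
    rw [hyv] at hv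
    refine ⟨hU.mem_recognizedSet_iff ⟨hv, hh ht, hg⟩ _, ?_⟩
    rw [← hv]
    have h1 := le_val_of_head?_ne_zero (U := U) (hh ht) (by simp [hx0 t ht])
    have h2 := hU.lt_apply (((x t ++ y).map Fin.val).length - 1)
    rw [List.length_map, List.length_append, hy] at h1 h2
    omega
  -- Equal states accept the same continuations, so X looks the same after `n t` and after `n t'`,
  -- and `n t' - n t` is an ultimate period.
  have hinj : ∀ t t', t ≠ 0 → t' ≠ 0 → A.eval (x t) = A.eval (x t') → n t ≤ n t' →
      n t ≡ n t' [MOD q] := by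
    intro t t' ht ht' heq hle
    rcases eq_or_lt_of_le hle with hlt | hlt
    · rw [hlt]
    rw [Nat.modEq_iff_dvd' hle]
    refine period_dvd ⟨by omega, n t + q, fun N hN => ?_⟩
    obtain ⟨u, hu⟩ : ∃ u, N = n t + u := ⟨N - n t, by omega⟩
    have hr : u % q < q := Nat.mod_lt _ hper.1
    obtain ⟨y, hy, hyg, hyv⟩ := hU.exists_isPaddedGreedy (s + q) (u % q) (by omega)
    obtain ⟨h1, h1'⟩ := hrep t ht _ hr y hy hyg hyv
    obtain ⟨h2, h2'⟩ := hrep t' ht' _ hr y hy hyg hyv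
    have e1 : (N ∈ X ↔ n t + u % q ∈ X) := by
      refine hs _ ?_ _ h1' ?_
      · have := Nat.mod_le u q
        omega
      · rw [hu]
        exact (Nat.mod_modEq u q).symm.add_left _
    have e2 : (N + (n t' - n t) ∈ X ↔ n t' + u % q ∈ X) := by
      refine hs _ ?_ _ h2' ?_
      · have := Nat.mod_le u q
        omega
      · rw [show N + (n t' - n t) = n t' + u by omega]
        exact (Nat.mod_modEq u q).symm.add_left _
    rw [e1, e2, h1, h2]
    simp only [DFA.mem_accepts, DFA.eval, DFA.evalFrom_of_append] at heq ⊢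
    rw [heq]
  have hinj' : ∀ t t', t ≠ 0 → t' ≠ 0 → A.eval (x t) = A.eval (x t') →
      n t ≡ n t' [MOD q] := by
    intro t t' ht ht' heq
    rcases le_total (n t) (n t') with h | h
    · exact hinj t t' ht ht' heq h
    · exact (hinj t' t ht' ht heq.symm h).symm
  have hcancel : ∀ t t', t ≤ t' → t * c ≡ t' * c [MOD q] → p ^ (e - l + 1) ∣ t' - t := by
    intro t t' hle h
    have h1 : p ^ e ∣ (t' - t) * c := by
      rw [Nat.sub_mul]
      exact hdvd.trans ((Nat.modEq_iff_dvd' (Nat.mul_le_mul_right _ hle)).1 h)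
    by_contra hnd
    -- With `p ^ (e - l + 1) ∤ t' - t` and `p ^ l ∤ c`, the valuation of the product would be at
    -- most (e - l) + (l - 1) = e - 1.
    rw [show e = (e - l) + (l - 1) + 1 by omega] at h1
    rcases pow_succ_dvd_or_of_dvd_mul hp h1 with h | h
    · exact hnd h
    · rw [Nat.sub_add_cancel hl] at h
      exact hpc h
  have hcard : (Finset.range (p ^ (e - l + 1))).card ≤ (Finset.univ : Finset (Fin m)).card := by
    -- The shift to `t + 1` avoids the empty prefix, after which a padded block could begin with 0.
    refine Finset.card_le_card_of_injOn (fun t => A.eval (x (t + 1))) (by simp) ?_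
    have key : ∀ t t', t ≤ t' → t' < p ^ (e - l + 1) → A.eval (x (t + 1)) = A.eval (x (t' + 1)) →
        t = t' := by
      intro t t' hle hlt heq
      have h1 := hinj' _ _ (by simp) (by simp) heq
      have h2 := hcancel (t + 1) (t' + 1) (by omega)
        (((hn _).symm.trans h1).trans (hn _))
      have := Nat.eq_zero_of_dvd_of_lt h2 (by omega)
      omega
    intro t ht t' ht' heq
    simp only [Finset.coe_range, Set.mem_Iio] at ht ht'
    rcases le_total t t' with h | h
    · exact key t t' h ht' heq
    · exact (key t' t h ht heq.symm).symm
  simpa using hcard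

/-! ### Divisibility along recurrences and the Hankel determinant -/

section Recurrence

variable {k : ℕ} {a : Fin k → ℤ} {e : ℕ → ℤ}

theorem dvd_of_forall_lt_dvd {d : ℤ} (he : ∀ i, e (i + k) = ∑ j : Fin k, a j * e (i + j))
    (h0 : ∀ i < k, d ∣ e i) (i : ℕ) : d ∣ e i := by
  induction i using Nat.strong_induction_on with
  | _ i ih =>
    by_cases hi : i < k
    · exact h0 i hi
    · obtain ⟨i, rfl⟩ := Nat.exists_eq_add_of_le' (not_lt.1 hi)
      rw [he i]
      exact Finset.dvd_sum fun j _ => Dvd.dvd.mul_left (ih _ (by omega)) _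

/-- Modulo `p` the terms before `j₀` drop out of the recurrence and the coefficient at `j₀` is
invertible, so each term of index at least `j₀` is determined by later ones and divisibility
propagates backwards. -/
theorem dvd_of_eventually_dvd {p : ℤ} (hp : Prime p)
    (he : ∀ i, e (i + k) = ∑ j : Fin k, a j * e (i + j)) {j₀ : Fin k} (hj₀ : ¬ p ∣ a j₀)
    (hlt : ∀ j < j₀, p ∣ a j) (hev : ∀ᶠ i in atTop, p ∣ e i) {i : ℕ} (hi : j₀ ≤ i) :
    p ∣ e i := by
  obtain ⟨T, hT⟩ := eventually_atTop.1 hev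
  induction T with
  | zero => exact hT i (Nat.zero_le _)
  | succ T ih =>
    by_cases hTj : T < j₀
    · exact hT i (by omega)
    refine ih fun b hb => ?_
    rcases eq_or_lt_of_le hb with rfl | hb
    · obtain ⟨r, rfl⟩ := Nat.exists_eq_add_of_le' (not_lt.1 hTj)
      have hsum := he r
      rw [← Finset.add_sum_erase _ _ (Finset.mem_univ j₀)] at hsum
      have hrest : p ∣ ∑ j ∈ Finset.univ.erase j₀, a j * e (r + j) := by
        refine Finset.dvd_sum fun j hj => ?_
        rcases lt_or_gt_of_ne (Finset.ne_of_mem_erase hj) with h | h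
        · exact Dvd.dvd.mul_right (hlt j h) _
        · exact Dvd.dvd.mul_left (hT _ (by have := Fin.lt_def.1 h; omega)) _
      have hlast : p ∣ e (r + k) := hT _ (by omega)
      rw [hsum] at hlast
      exact (hp.dvd_or_dvd ((Int.dvd_iff_dvd_of_dvd_add hlast).2 hrest)).resolve_left hj₀
    · exact hT b hb

end Recurrence

/-- The Hankel matrix of order `k` of the sequence `U`, starting at index `N`. -/
def hankel (U : ℕ → ℕ) (k N : ℕ) : Matrix (Fin k) (Fin k) ℤ :=
  Matrix.of fun s i => (U (N + s + i) : ℤ)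

/-- The shift operator on sequences. -/
def shift : Module.End ℚ (ℕ → ℚ) := LinearMap.funLeft ℚ ℚ Nat.succ

theorem shift_pow_apply (n : ℕ) (f : ℕ → ℚ) (i : ℕ) : (shift ^ n) f i = f (i + n) := by
  induction n generalizing i with
  | zero => rfl
  | succ n ih =>
    rw [pow_succ', Module.End.mul_apply]
    exact (ih (i + 1)).trans (by rw [add_assoc, add_comm 1 n])

open Polynomial in
theorem aeval_shift_apply (P : ℚ[X]) (f : ℕ → ℚ) (i : ℕ) :
    aeval shift P f i = ∑ j ∈ Finset.range (P.natDegree + 1), P.coeff j * f (i + j) := by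
  rw [aeval_eq_sum_range]
  simp [shift_pow_apply]

open Polynomial in
-- The gcd of `P` and `V` still annihilates the sequence by Bézout. Dividing the monic integer
-- polynomial `P`, it is by Gauss's lemma a scalar times a monic integer polynomial, whose constant
-- term is nonzero because that of `P` is. This turns a rational relation into an admissible
-- integral one.
theorem exists_recurrence_of_annihilator {U : ℕ → ℕ} (hU : IsNumerationSystem U) {N : ℕ}
    {P : ℤ[X]} (hP : P.Monic) (hP0 : P.coeff 0 ≠ 0) {V : ℚ[X]} (hV : V ≠ 0)
    (hPu : aeval shift (P.map (algebraMap ℤ ℚ)) (fun i => (U (N + i) : ℚ)) = 0)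
    (hVu : aeval shift V (fun i => (U (N + i) : ℚ)) = 0) :
    ∃ (n : ℕ) (b : Fin n → ℤ), n ≤ V.natDegree ∧ IsRecurrence U n b N := by
  set u : ℕ → ℚ := fun i => (U (N + i) : ℚ) with hu
  set P' := P.map (algebraMap ℤ ℚ) with hP'
  set g := EuclideanDomain.gcd P' V with hg
  have hgP : g ∣ P' := EuclideanDomain.gcd_dvd_left _ _
  have hgV : g ∣ V := EuclideanDomain.gcd_dvd_right _ _
  have hg0 : g ≠ 0 := fun h => hV (zero_dvd_iff.1 (h ▸ hgV))
  have hgu : aeval shift g u = 0 := by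
    rw [hg, EuclideanDomain.gcd_eq_gcd_ab, mul_comm P', mul_comm V, map_add, map_mul, map_mul,
      LinearMap.add_apply, Module.End.mul_apply, Module.End.mul_apply, hPu, hVu, map_zero,
      map_zero, add_zero]
  obtain ⟨g', hg'⟩ := IsIntegrallyClosed.eq_map_mul_C_of_dvd ℚ hP hgP
  have hlc : g.leadingCoeff ≠ 0 := leadingCoeff_ne_zero.2 hg0
  have hinj : Function.Injective (algebraMap ℤ ℚ) := (algebraMap ℤ ℚ).injective_int
  have hmon : g'.Monic := by
    have h := congrArg leadingCoeff hg'
    rw [leadingCoeff_mul, leadingCoeff_C, mul_eq_right₀ hlc, leadingCoeff_map_of_injective hinj]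
      at h
    exact hinj (h.trans (map_one _).symm)
  have hg'u : aeval shift (g'.map (algebraMap ℤ ℚ)) u = 0 := by
    rw [← hg', mul_comm, map_mul, aeval_C, Module.End.mul_apply,
      Module.algebraMap_end_apply] at hgu
    exact (smul_eq_zero.1 hgu).resolve_left hlc
  have hrel : ∀ i, ∑ j ∈ Finset.range (g'.natDegree + 1),
      g'.coeff j * (U (N + (i + j)) : ℤ) = 0 := by
    intro i
    have h := congrFun hg'u i
    rw [aeval_shift_apply, natDegree_map_eq_of_injective hinj] at h
    simp only [coeff_map, hu, Pi.zero_apply, algebraMap_int_eq, eq_intCast] at h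
    exact_mod_cast h
  -- A recurrence of order 0 would force `U N = 0`.
  have hdeg : g'.natDegree ≠ 0 := by
    intro h0
    have h := hrel 0
    rw [h0, hmon.natDegree_eq_zero.1 h0] at h
    simp only [zero_add, Finset.range_one, Finset.sum_singleton, coeff_one_zero, one_mul] at h
    exact (hU.pos _).ne' (by exact_mod_cast h)
  refine ⟨g'.natDegree, fun j => -g'.coeff j, ?_, Nat.pos_of_ne_zero hdeg, ?_, ?_⟩
  · rw [← natDegree_map_eq_of_injective hinj, ← natDegree_mul_C hlc, hg']
    exact natDegree_le_of_dvd hgV hV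
  · obtain ⟨h, hh⟩ := hgP
    intro h0
    have h1 : g'.coeff 0 = 0 := by simpa using h0
    have h2 := congrArg (fun Q => coeff Q 0) hh
    rw [mul_coeff_zero, ← hg', mul_coeff_zero, hP', coeff_map, coeff_map, h1, map_zero, zero_mul,
      zero_mul] at h2
    exact hP0 (hinj (h2.trans (map_zero _).symm))
  · intro i hi
    obtain ⟨i, rfl⟩ := Nat.exists_eq_add_of_le hi
    have h := hrel i
    rw [Finset.sum_range_succ, hmon.coeff_natDegree, one_mul, ← Fin.sum_univ_eq_sum_range
      (fun j => g'.coeff j * (U (N + (i + j)) : ℤ))] at h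
    simp only [neg_mul, Finset.sum_neg_distrib, add_assoc]
    linarith

open Polynomial in
-- A left kernel vector gives a relation between k consecutive terms, that is, an annihilator of
-- degree less than k, against minimality.
theorem det_hankel_ne_zero {U : ℕ → ℕ} (hU : IsNumerationSystem U) {k N : ℕ} {a : Fin k → ℤ}
    (hrec : IsMinimalRecurrence U k a N) : (hankel U k N).det ≠ 0 := by
  intro hdet
  obtain ⟨v, hv0, hv⟩ := Matrix.exists_vecMul_eq_zero_iff.2 hdet
  have hw : ∀ i, ∑ s : Fin k, v s * (U (N + s + i) : ℤ) = 0 := by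
    -- Divisibility by 0 expresses vanishing, so the first k zeros propagate to all indices.
    have hall : ∀ i, (0 : ℤ) ∣ ∑ s : Fin k, v s * (U (N + s + i) : ℤ) := by
      refine dvd_of_forall_lt_dvd (a := a) (fun i => ?_) (fun i hi => ?_)
      · simp_rw [Finset.mul_sum]
        rw [Finset.sum_comm]
        refine Finset.sum_congr rfl fun s _ => ?_
        rw [← add_assoc, hrec.relation _ (by omega), Finset.mul_sum]
        refine Finset.sum_congr rfl fun j _ => ?_
        rw [add_assoc (N + s) i j]
        ring
      · have := congrFun hv ⟨i, hi⟩
        simp only [Matrix.vecMul, dotProduct, hankel, Matrix.of_apply, Pi.zero_apply] at this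
        rw [this]
    exact fun i => zero_dvd_iff.1 (hall i)
  set P : ℤ[X] := X ^ k - ∑ j : Fin k, C (a j) * X ^ (j : ℕ) with hP
  set V : ℚ[X] := ∑ j : Fin k, C (v j : ℚ) * X ^ (j : ℕ) with hV
  have hVdeg : V.degree < k := degree_sum_fin_lt _
  have hVc : ∀ j : Fin k, V.coeff j = v j := by
    intro j
    simp [hV, coeff_X_pow, Fin.val_inj]
  have hV0 : V ≠ 0 := by
    intro h
    apply hv0
    funext j
    have := hVc j
    rw [h, coeff_zero] at this
    exact_mod_cast this.symm
  have hmon : P.Monic := monic_X_pow_sub (degree_sum_fin_lt _)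
  have hP0 : P.coeff 0 ≠ 0 := by
    have h : P.coeff 0 = -a ⟨0, hrec.pos⟩ := by
      rw [hP, coeff_sub, coeff_X_pow, if_neg hrec.pos.ne, finsetSum_coeff,
        Finset.sum_eq_single ⟨0, hrec.pos⟩]
      · simp
      · intro b _ hb
        have : (0 : ℕ) ≠ b := fun h => hb (Fin.ext h.symm)
        simp [coeff_X_pow, this]
      · simp
    rw [h]
    exact neg_ne_zero.2 hrec.coeff_zero_ne
  obtain ⟨n, b, hn, hb⟩ := exists_recurrence_of_annihilator hU (N := N) hmon hP0 hV0 (by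
      funext i
      have h := hrec.relation (N + i) (by omega)
      have h' : (U (N + i + k) : ℚ) = ∑ j : Fin k, (a j : ℚ) * U (N + i + j) := by exact_mod_cast h
      simp only [hP, Polynomial.map_sub, Polynomial.map_pow, map_X, Polynomial.map_sum,
        Polynomial.map_mul, map_C, map_sub, map_sum, map_mul, map_pow, aeval_X, aeval_C,
        LinearMap.sub_apply, LinearMap.sum_apply, Module.End.mul_apply,
        Module.algebraMap_end_apply, Pi.sub_apply, Finset.sum_apply, Pi.smul_apply, smul_eq_mul,
        shift_pow_apply, Pi.zero_apply, ← add_assoc, algebraMap_int_eq, Int.coe_castRingHom]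
      rw [h', sub_self]) (by
      funext i
      have h' : ∑ s : Fin k, (v s : ℚ) * U (N + s + i) = 0 := by exact_mod_cast hw i
      simp only [hV, map_sum, map_mul, map_pow, aeval_X, aeval_C, LinearMap.sum_apply,
        Module.End.mul_apply, Module.algebraMap_end_apply, Finset.sum_apply, Pi.smul_apply,
        smul_eq_mul, shift_pow_apply, Pi.zero_apply]
      rw [← h']
      refine Finset.sum_congr rfl fun s _ => ?_
      rw [add_comm i, ← add_assoc])
  have h1 := hrec.minimal n b N hb
  have h2 := (natDegree_lt_iff_degree_lt hV0).2 hVdeg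
  omega

theorem exists_not_dvd_coeff {k : ℕ} {a : Fin k → ℤ} (hgcd : Finset.univ.gcd a = 1) {p : ℕ}
    (hp : p.Prime) : ∃ j₀, ¬ (p : ℤ) ∣ a j₀ ∧ ∀ j < j₀, (p : ℤ) ∣ a j := by
  have hne : ∃ j, ¬ (p : ℤ) ∣ a j := by
    by_contra! h
    have : (p : ℤ) ∣ 1 := hgcd ▸ Finset.dvd_gcd fun j _ => h j
    exact hp.one_lt.ne' (by exact_mod_cast Int.eq_one_of_dvd_one (by positivity) this)
  obtain ⟨j₀, h, hmin⟩ := WellFounded.has_min (wellFounded_lt (α := Fin k))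
    {j | ¬ (p : ℤ) ∣ a j} hne
  exact ⟨j₀, h, fun j hj => not_not.1 fun hn => hmin j hn hj⟩

/-- Row `j₀` of the adjugate combines shifts of U into D times the integer solution `e` whose first
k terms are the unit vector at `j₀`. If `p ^ (v + 1)` eventually divided U, then p would eventually
divide `e`, hence, going backwards, `e j₀ = 1`. -/
theorem frequently_not_dvd {U : ℕ → ℕ} (hU : IsNumerationSystem U) {k N : ℕ} {a : Fin k → ℤ}
    (hrec : IsMinimalRecurrence U k a N) (hgcd : Finset.univ.gcd a = 1) {p : ℕ} (hp : p.Prime)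
    {v : ℕ} (hv : ¬ p ^ (v + 1) ∣ (hankel U k N).det.natAbs) :
    ∃ᶠ j in atTop, ¬ p ^ (v + 1) ∣ U j := by
  intro hev
  simp only [not_not] at hev
  set D := (hankel U k N).det with hD
  have hD0 : D ≠ 0 := det_hankel_ne_zero hU hrec
  obtain ⟨j₀, hj₀, hlt⟩ := exists_not_dvd_coeff hgcd hp
  set c : Fin k → ℤ := (hankel U k N).adjugate j₀ with hc
  set f : ℕ → ℤ := fun i => ∑ s : Fin k, c s * (U (N + s + i) : ℤ) with hf
  have hfrec : ∀ i, f (i + k) = ∑ j : Fin k, a j * f (i + j) := by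
    intro i
    simp only [hf, Finset.mul_sum]
    rw [Finset.sum_comm]
    refine Finset.sum_congr rfl fun s _ => ?_
    rw [← add_assoc, hrec.relation _ (by omega), Finset.mul_sum]
    refine Finset.sum_congr rfl fun j _ => ?_
    rw [add_assoc (N + s) i j]
    ring
  have hf0 : ∀ i : Fin k, f i = D * (1 : Matrix (Fin k) (Fin k) ℤ) j₀ i := by
    intro i
    have := congrFun (congrFun (Matrix.adjugate_mul (hankel U k N)) j₀) i
    rw [Matrix.mul_apply, Matrix.smul_apply, smul_eq_mul] at this
    exact this
  have hdvd : ∀ i, D ∣ f i := dvd_of_forall_lt_dvd hfrec fun i hi =>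
    (hf0 ⟨i, hi⟩).symm ▸ Dvd.intro _ rfl
  choose e he using hdvd
  have herec : ∀ i, e (i + k) = ∑ j : Fin k, a j * e (i + j) := by
    intro i
    apply mul_left_cancel₀ hD0
    rw [← he, hfrec, Finset.mul_sum]
    refine Finset.sum_congr rfl fun j _ => ?_
    rw [he]
    ring
  have he1 : e j₀ = 1 := by
    have := hf0 j₀
    rw [he, Matrix.one_apply_eq] at this
    exact mul_left_cancel₀ hD0 this
  have hevp : ∀ᶠ i in atTop, (p : ℤ) ∣ e i := by
    obtain ⟨T, hT⟩ := eventually_atTop.1 hev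
    filter_upwards [eventually_ge_atTop T] with i hi
    have h1 : ((p ^ (v + 0 + 1) : ℕ) : ℤ) ∣ f i := by
      refine Finset.dvd_sum fun s _ => Dvd.dvd.mul_left ?_ _
      exact_mod_cast hT _ (by omega)
    rw [he, Int.natCast_dvd, Int.natAbs_mul] at h1
    have h2 := (pow_succ_dvd_or_of_dvd_mul (u := v) (v := 0) hp h1).resolve_left hv
    rw [zero_add, pow_one] at h2
    exact Int.natCast_dvd.2 h2
  have h := dvd_of_eventually_dvd (Nat.prime_iff_prime_int.1 hp) herec hj₀ hlt hevp le_rfl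
  rw [he1] at h
  exact hp.one_lt.ne' (by exact_mod_cast Int.eq_one_of_dvd_one (by positivity) h)

/-- Here `a 0` itself is invertible modulo p, so the backward argument applies to U directly and
reaches `U N`, which is positive and less than p. -/
theorem frequently_not_dvd_of_lt {U : ℕ → ℕ} (hU : IsNumerationSystem U) {k N : ℕ}
    {a : Fin k → ℤ} (hrec : IsRecurrence U k a N) {p : ℕ} (hp : p.Prime)
    (hpa : |a ⟨0, hrec.pos⟩| < p) (hpN : U N < p) : ∃ᶠ j in atTop, ¬ p ∣ U j := by
  intro hev
  simp only [not_not] at hev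
  have h : (p : ℤ) ∣ (U (N + 0) : ℤ) := by
    refine dvd_of_eventually_dvd (a := a) (e := fun i => (U (N + i) : ℤ)) (i := 0)
      (j₀ := ⟨0, hrec.pos⟩) (Nat.prime_iff_prime_int.1 hp) (fun i => ?_) (fun h => ?_) (fun j hj => ?_) ?_ le_rfl
    · simpa [add_assoc] using hrec.relation (N + i) (by omega)
    · exact hrec.coeff_zero_ne (Int.eq_zero_of_abs_lt_dvd h hpa)
    · exact absurd (Fin.lt_def.1 hj) (Nat.not_lt_zero _)
    · obtain ⟨T, hT⟩ := eventually_atTop.1 hev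
      filter_upwards [eventually_ge_atTop T] with i hi
      exact_mod_cast hT _ (by omega)
  have h' : p ∣ U N := by exact_mod_cast h
  exact absurd (Nat.le_of_dvd (hU.pos N) h') (by omega)

open Nat in
-- Of a prime power in the period, the part up to v_p(D) divides D; any excess is a power of p that
-- is at most m, hence divides m!.
theorem period_dvd_factorial_mul_det {U : ℕ → ℕ} (hU : IsNumerationSystem U) {k N : ℕ}
    {a : Fin k → ℤ} (hrec : IsMinimalRecurrence U k a N) (hgcd : Finset.univ.gcd a = 1)
    (h2 : H2 U) (h3 : H3 U) {m : ℕ} (A : DFA (Fin (alphabetSize U)) (Fin m))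
    (hX : UltimatelyPeriodic (recognizedSet U A.accepts)) :
    period (recognizedSet U A.accepts) ∣ m ! * (hankel U k N).det.natAbs := by
  rw [Nat.dvd_iff_prime_pow_dvd_dvd]
  intro p e hp hpe
  have hD : (hankel U k N).det.natAbs ≠ 0 := Int.natAbs_ne_zero.2 (det_hankel_ne_zero hU hrec)
  set v := (hankel U k N).det.natAbs.factorization p
  have h1 : p ^ v ∣ (hankel U k N).det.natAbs := Nat.ordProj_dvd _ _
  have h2' : ¬ p ^ (v + 1) ∣ (hankel U k N).det.natAbs := Nat.pow_succ_factorization_not_dvd hD hp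
  by_cases he : e ≤ v
  · exact Dvd.dvd.mul_left ((pow_dvd_pow p he).trans h1) _
  · have h := pow_le_card_of_dvd_period hU h2 h3 hp (Nat.succ_le_succ (Nat.zero_le v))
      (frequently_not_dvd hU hrec hgcd hp h2') A hX (show v + 1 ≤ e by omega) hpe
    rw [show e = (e - (v + 1) + 1) + v by omega, pow_add]
    exact Nat.mul_dvd_mul (Nat.dvd_factorial (pow_pos hp.pos _) h) h1

/-- This crude bound spares the algorithm from computing a determinant: D divides the factorial of
the bound. -/
theorem natAbs_det_hankel_le {U : ℕ → ℕ} (hU : IsNumerationSystem U) (k N : ℕ) :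
    (hankel U k N).det.natAbs ≤ (k * U (N + 2 * k)) ^ k := by
  have h := Matrix.det_le (A := hankel U k N) (abv := AbsoluteValue.abs)
    (x := (U (N + 2 * k) : ℤ)) fun i j => by
      simp only [hankel, Matrix.of_apply, AbsoluteValue.abs_apply, Nat.abs_cast]
      exact_mod_cast hU.strictMono.monotone (by omega)
  rw [Fintype.card_fin, AbsoluteValue.abs_apply, Int.abs_eq_natAbs, nsmul_eq_mul] at h
  rw [mul_pow]
  exact (show (hankel U k N).det.natAbs ≤ k.factorial * U (N + 2 * k) ^ k by
    exact_mod_cast h).trans (Nat.mul_le_mul_right _ (Nat.factorial_le_pow k))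

/-! ### Pumping words up and down -/

section Pumping

variable {α σ : Type*} [Fintype σ] (M : DFA α σ)

theorem exists_mem_accepts_length_ge {x : List α} (hx : x ∈ M.accepts)
    (hlen : Fintype.card σ ≤ x.length) (n : ℕ) : ∃ y ∈ M.accepts, n ≤ y.length := by
  obtain ⟨a, b, c, -, -, hb, hsub⟩ := M.pumping_lemma hx hlen
  refine ⟨a ++ (List.replicate n b).flatten ++ c, hsub ?_, ?_⟩
  · exact Language.append_mem_mul (Language.append_mem_mul rfl
      (Language.mem_kstar.2 ⟨_, rfl, fun y hy => List.eq_of_mem_replicate hy⟩)) rfl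
  · have := Nat.mul_le_mul_left n (List.length_pos_iff.2 hb)
    simp only [List.length_append, List.length_flatten, List.map_replicate, List.sum_replicate,
      smul_eq_mul]
    omega

theorem exists_mem_accepts_length_lt {x : List α} (hx : x ∈ M.accepts)
    (hlen : Fintype.card σ ≤ x.length) :
    ∃ y ∈ M.accepts, Fintype.card σ ≤ y.length ∧ y.length < 2 * Fintype.card σ := by
  induction hn : x.length using Nat.strong_induction_on generalizing x with
  | _ n ih =>
    by_cases hlt : x.length < 2 * Fintype.card σ
    · exact ⟨x, hx, hlen, hlt⟩
    obtain ⟨a, b, c, hxe, hab, hb, hsub⟩ := M.pumping_lemma hx hlen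
    have hmem : a ++ [] ++ c ∈ M.accepts := hsub (Language.append_mem_mul
      (Language.append_mem_mul rfl (Language.nil_mem_kstar _)) rfl)
    have hpos := List.length_pos_iff.2 hb
    have hl : x.length = a.length + b.length + c.length := by simp [hxe, add_assoc]
    have hl' : (a ++ [] ++ c).length = a.length + c.length := by simp
    -- A pumped-out factor has at most `Fintype.card σ` letters, so from length at least twice that
    -- number the descent cannot jump below the window.
    exact ih _ (by omega) hmem (by omega) rfl

end Pumping

/-! ### Residues of values and the test of one candidate period -/

section Residue

variable {U : ℕ → ℕ} {k : ℕ} {a : Fin k → ℤ} {N : ℕ}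

theorem val_recurrence (hrec : IsRecurrence U k a N) (w : List ℕ) :
    (val (fun i => U (i + (N + k))) w : ℤ) =
      ∑ j : Fin k, a j * (val (fun i => U (i + (N + j))) w : ℤ) := by
  induction w with
  | nil => simp [val]
  | cons d w ih =>
    simp only [val, Nat.cast_add, Nat.cast_mul, mul_add, Finset.sum_add_distrib, ih]
    rw [← add_assoc, hrec.relation _ (by omega), Finset.mul_sum]
    congr 1
    refine Finset.sum_congr rfl fun j _ => ?_
    rw [← add_assoc]
    ring

/-- The automaton computing the residues modulo `Q` of the values of all shifts of a word. -/
def residueDFA (U : ℕ → ℕ) {k : ℕ} (a : Fin k → ℤ) (N c Q : ℕ) (r : ZMod Q) :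
    DFA (Fin c) (Fin (N + k) → ZMod Q) where
  step s d := fun j =>
    (if h : j + 1 < N + k then s ⟨j + 1, h⟩ else ∑ i : Fin k, (a i : ZMod Q) * s (Fin.natAdd N i)) +
      d * U j
  start := 0
  accept := {s | ∀ h : 0 < N + k, s ⟨0, h⟩ = r}

/-- Appending a digit `d` turns the value at shift `j` into the old value at shift `j + 1` plus `d *
U j`; the last coordinate is closed up by the recurrence. -/
theorem residueDFA_eval (hrec : IsRecurrence U k a N) {c Q : ℕ} (r : ZMod Q) (w : List (Fin c)) :
    (residueDFA U a N c Q r).eval w =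
      fun j : Fin (N + k) => (val (fun i => U (i + j)) (w.map Fin.val) : ZMod Q) := by
  induction w using List.reverseRecOn with
  | nil =>
    funext j
    simp [residueDFA, val]
  | append_singleton w d ih =>
    rw [DFA.eval_append_singleton, ih]
    funext j
    rw [List.map_append, val_append]
    simp only [residueDFA, List.map_cons, List.map_nil, List.length_cons, List.length_nil, zero_add,
      val, add_zero, Nat.cast_add, Nat.cast_mul, add_assoc, add_comm 1 (j : ℕ)]
    congr 1
    split_ifs with h
    · rfl
    · have hj : (j : ℕ) + 1 = N + k := by omega
      rw [hj]
      have := congrArg (Int.cast : ℤ → ZMod Q) (val_recurrence hrec (w.map Fin.val))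
      push_cast at this
      rw [this]
      rfl

theorem mem_residueDFA_accepts (hrec : IsRecurrence U k a N) {c Q : ℕ} (r : ZMod Q)
    (w : List (Fin c)) :
    w ∈ (residueDFA U a N c Q r).accepts ↔ (val U (w.map Fin.val) : ZMod Q) = r := by
  have h : 0 < N + k := Nat.add_pos_right N hrec.pos
  rw [DFA.mem_accepts, residueDFA_eval hrec]
  simp [residueDFA, h]

end Residue

/-- Ultimate periodicity modulo `Q` only has to be tested on words whose length is between `T` and
`2 * T`, where `T` is the number of states of a product automaton. -/
theorem isUltimatePeriod_iff {U : ℕ → ℕ} (hU : IsNumerationSystem U) {k N : ℕ} {a : Fin k → ℤ}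
    (hrec : IsRecurrence U k a N) {b m Q T : ℕ} (hQ : 0 < Q)
    (B : DFA (Fin (alphabetSize U)) (Fin b)) (A : DFA (Fin (alphabetSize U)) (Fin m))
    (hB : B.accepts = repLanguage U Set.univ) (hT : T = b * Q ^ (N + k) * m) :
    IsUltimatePeriod (recognizedSet U A.accepts) Q ↔
      ∀ w ∈ B.accepts, ∀ w' ∈ B.accepts, T ≤ w.length → w.length < 2 * T → T ≤ w'.length →
        w'.length < 2 * T → val U (w.map Fin.val) ≡ val U (w'.map Fin.val) [MOD Q] →
        w ∈ A.accepts → w' ∈ A.accepts := by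
  have : NeZero Q := ⟨hQ.ne'⟩
  set X := recognizedSet U A.accepts with hX
  have hBrep : ∀ w ∈ B.accepts, IsGreedyRep U (val U (w.map Fin.val)) (w.map Fin.val) := by
    intro w hw
    rw [hB] at hw
    obtain ⟨n, -, hn⟩ := hw
    rw [hn.1]
    exact hn
  have hBmem : ∀ w n, IsGreedyRep U n (w.map Fin.val) → w ∈ B.accepts := by
    intro w n hw
    rw [hB]
    exact ⟨n, trivial, hw⟩
  have hXmem : ∀ w ∈ B.accepts, (val U (w.map Fin.val) ∈ X ↔ w ∈ A.accepts) := fun w hw =>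
    hU.mem_recognizedSet_iff (hBrep w hw) _
  have hmach : ∀ (C : DFA (Fin (alphabetSize U)) (Fin m)) (r : ZMod Q),
      ∃ M : DFA (Fin (alphabetSize U)) ((Fin b × (Fin (N + k) → ZMod Q)) × Fin m),
        ∀ w, w ∈ M.accepts ↔
          (w ∈ B.accepts ∧ (val U (w.map Fin.val) : ZMod Q) = r) ∧ w ∈ C.accepts := by
    intro C r
    refine ⟨(B.inter (residueDFA U a N _ Q r)).inter C, fun w => ?_⟩
    rw [DFA.accepts_inter, DFA.accepts_inter, Language.mem_inf, Language.mem_inf,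
      mem_residueDFA_accepts hrec]
  have hcard : Fintype.card ((Fin b × (Fin (N + k) → ZMod Q)) × Fin m) = T := by
    simp [ZMod.card, hT]
  constructor
  · intro hper w hw w' hw' hl _ hl' _ hmod hwA
    by_contra hwA'
    obtain ⟨s, hs⟩ := hper.mem_iff_of_modEq
    -- A bad pair of test words is pumped up, keeping its residue and the verdicts of `A`, to a bad
    -- pair beyond the threshold `s`.
    obtain ⟨M, hM⟩ := hmach A (val U (w.map Fin.val))
    obtain ⟨M', hM'⟩ := hmach Aᶜ (val U (w.map Fin.val))
    obtain ⟨y, hy, hys⟩ := exists_mem_accepts_length_ge M ((hM w).2 ⟨⟨hw, rfl⟩, hwA⟩)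
      (hcard.trans_le hl) s
    obtain ⟨y', hy', hys'⟩ := exists_mem_accepts_length_ge M' ((hM' w').2 ⟨⟨hw',
      ((ZMod.natCast_eq_natCast_iff _ _ _).2 hmod).symm⟩, by rwa [DFA.accepts_compl]⟩)
      (hcard.trans_le hl') s
    obtain ⟨⟨hyB, hyv⟩, hyA⟩ := (hM y).1 hy
    obtain ⟨⟨hyB', hyv'⟩, hyA'⟩ := (hM' y').1 hy'
    have h1 := hU.length_le_of_isGreedyRep (hBrep y hyB)
    have h2 := hU.length_le_of_isGreedyRep (hBrep y' hyB')
    rw [List.length_map] at h1 h2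
    have h := (hs _ (hys.trans h1) _ (hys'.trans h2)
      ((ZMod.natCast_eq_natCast_iff _ _ _).1 (hyv.trans hyv'.symm))).1 ((hXmem y hyB).2 hyA)
    rw [hXmem y' hyB'] at h
    rw [DFA.accepts_compl] at hyA'
    exact hyA' h
  · intro hcheck
    -- From `U T` on, representations are longer than `T`, so a bad pair of integers can be pumped
    -- down to a bad pair of test words.
    have key : ∀ n n', U T ≤ n → U T ≤ n' → n ≡ n' [MOD Q] → n ∈ X → n' ∈ X := by
      intro n n' hn hn' hmod hnX
      by_contra hnX'
      obtain ⟨w, hw⟩ := hU.exists_isGreedyRep n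
      obtain ⟨w', hw'⟩ := hU.exists_isGreedyRep n'
      obtain ⟨M, hM⟩ := hmach A (n : ZMod Q)
      obtain ⟨M', hM'⟩ := hmach Aᶜ (n : ZMod Q)
      have hl := hU.le_length_of_isGreedyRep hw hn
      have hl' := hU.le_length_of_isGreedyRep hw' hn'
      rw [List.length_map] at hl hl'
      have hwM : w ∈ M.accepts := (hM w).2 ⟨⟨hBmem w n hw, by rw [hw.1]⟩,
        (hU.mem_recognizedSet_iff hw _).1 hnX⟩
      have hwM' : w' ∈ M'.accepts := (hM' w').2 ⟨⟨hBmem w' n' hw', by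
        rw [hw'.1]
        exact ((ZMod.natCast_eq_natCast_iff _ _ _).2 hmod).symm⟩, by
        rw [DFA.accepts_compl]
        exact fun h => hnX' ((hU.mem_recognizedSet_iff hw' _).2 h)⟩
      obtain ⟨y, hy, hy1, hy2⟩ := exists_mem_accepts_length_lt M hwM (hcard.trans_le hl.le)
      obtain ⟨y', hy', hy1', hy2'⟩ := exists_mem_accepts_length_lt M' hwM' (hcard.trans_le hl'.le)
      rw [hcard] at hy1 hy2 hy1' hy2'
      obtain ⟨⟨hyB, hyv⟩, hyA⟩ := (hM y).1 hy
      obtain ⟨⟨hyB', hyv'⟩, hyA'⟩ := (hM' y').1 hy'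
      rw [DFA.accepts_compl] at hyA'
      exact hyA' (hcheck y hyB y' hyB' hy1 hy2 hy1' hy2'
        ((ZMod.natCast_eq_natCast_iff _ _ _).1 (hyv.trans hyv'.symm)) hyA)
    refine ⟨hQ, U T, fun n hn => ⟨key _ _ hn (by omega) ?_, key _ _ (by omega) hn ?_⟩⟩
    · simp [Nat.ModEq]
    · simp [Nat.ModEq]

/-- A number which is a multiple of the period of every ultimately periodic set recognized by an
automaton with `m` states. -/
def periodMultiple (U : ℕ → ℕ) (k N m : ℕ) : ℕ :=
  m.factorial * ((k * U (N + 2 * k)) ^ k).factorial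

theorem periodMultiple_pos (U : ℕ → ℕ) (k N m : ℕ) : 0 < periodMultiple U k N m :=
  Nat.mul_pos (Nat.factorial_pos _) (Nat.factorial_pos _)

theorem ultimatelyPeriodic_iff {U : ℕ → ℕ} (hU : IsNumerationSystem U) {k N : ℕ} {a : Fin k → ℤ}
    (hrec : IsMinimalRecurrence U k a N) (hgcd : Finset.univ.gcd a = 1) (h2 : H2 U) (h3 : H3 U)
    {m : ℕ} (A : DFA (Fin (alphabetSize U)) (Fin m)) :
    UltimatelyPeriodic (recognizedSet U A.accepts) ↔
      IsUltimatePeriod (recognizedSet U A.accepts) (periodMultiple U k N m) := by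
  refine ⟨fun h => ?_, fun h => ⟨_, h⟩⟩
  refine h.isUltimatePeriod_period.of_dvd (periodMultiple_pos U k N m) ?_
  refine (period_dvd_factorial_mul_det hU hrec hgcd h2 h3 A h).trans (Nat.mul_dvd_mul_left _ ?_)
  exact Nat.dvd_factorial (Int.natAbs_pos.2 (det_hankel_ne_zero hU hrec))
    (natAbs_det_hankel_le hU k N)

theorem exists_period_exponent {U : ℕ → ℕ} (hU : IsNumerationSystem U) {k N : ℕ} {a : Fin k → ℤ}
    (hrec : IsMinimalRecurrence U k a N) (hgcd : Finset.univ.gcd a = 1) (h2 : H2 U) (h3 : H3 U)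
    {p : ℕ} (hp : p.Prime) :
    ∃ l : ℕ, 1 ≤ l ∧ (|a ⟨0, hrec.pos⟩| < p → U N < p → l = 1) ∧
      ∀ (m : ℕ) (A : DFA (Fin (alphabetSize U)) (Fin m)),
        UltimatelyPeriodic (recognizedSet U A.accepts) →
        ∀ e ≥ l, p ^ e ∣ period (recognizedSet U A.accepts) → p ^ (e - l + 1) ≤ m := by
  by_cases hsmall : |a ⟨0, hrec.pos⟩| < p ∧ U N < p
  · have hfr := frequently_not_dvd_of_lt hU hrec.toIsRecurrence hp hsmall.1 hsmall.2
    exact ⟨1, le_rfl, fun _ _ => rfl, fun m A hX e he hd =>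
      pow_le_card_of_dvd_period hU h2 h3 hp le_rfl (by simpa using hfr) A hX he hd⟩
  · have hD := Int.natAbs_ne_zero.2 (det_hankel_ne_zero hU hrec)
    have hfr := frequently_not_dvd hU hrec hgcd hp (Nat.pow_succ_factorization_not_dvd hD hp)
    -- The exponent is v_p(D) + 1, with D the Hankel determinant.
    exact ⟨_, Nat.succ_le_succ (Nat.zero_le _), fun h h' => absurd ⟨h, h'⟩ hsmall,
      fun m A hX e he hd =>
        pow_le_card_of_dvd_period hU h2 h3 hp (Nat.succ_le_succ (Nat.zero_le _)) hfr A hX he hd⟩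

/-! ### Primitive recursiveness of the decision procedure -/

section Primrec

variable {α β : Type*} [Primcodable α] [Primcodable β]

theorem primrec_list_sum : Primrec (List.sum : List ℕ → ℕ) :=
  (Primrec.list_foldr (f := id) (g := fun _ : List ℕ => 0)
    (h := fun _ p => p.1 + p.2) Primrec.id (Primrec.const 0)
    (Primrec.nat_add.comp₂ (Primrec.fst.comp₂ Primrec₂.right)
      (Primrec.snd.comp₂ Primrec₂.right))).of_eq fun l => by
    induction l with
    | nil => rfl
    | cons a l ih => simp_all

theorem primrec_list_all {f : α → List β} {p : α → β → Bool} (hf : Primrec f) (hp : Primrec₂ p) :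
    Primrec fun a => (f a).all (p a) :=
  (Primrec.list_foldr (g := fun _ : α => true) (h := fun a q => p a q.1 && q.2) hf
    (Primrec.const true)
    (Primrec.and.comp₂ (hp.comp₂ Primrec₂.left (Primrec.fst.comp₂ Primrec₂.right))
      (Primrec.snd.comp₂ Primrec₂.right))).of_eq fun a => by
    induction f a with
    | nil => rfl
    | cons b l ih => simp_all

theorem primrec_factorial : Primrec Nat.factorial :=
  (Primrec.nat_rec₁ (f := fun n r => (n + 1) * r) 1
    (Primrec.nat_mul.comp₂ (Primrec.succ.comp₂ Primrec₂.left) Primrec₂.right)).of_eq fun n => by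
    induction n with
    | zero => rfl
    | succ n ih => simp_all [Nat.factorial_succ]

theorem primrec_pow : Primrec₂ ((· ^ ·) : ℕ → ℕ → ℕ) :=
  Primrec₂.unpaired'.1 Nat.Primrec.pow

/-- Integers are encoded with n ≥ 0 as 2n and -(n+1) as 2n+1, so parity gives the sign and halving
the magnitude. -/
theorem primrec_int_toNat : Primrec Int.toNat :=
  (Primrec.cond (Primrec.nat_bodd.comp Primrec.encode) (Primrec.const 0)
    (Primrec.nat_div2.comp Primrec.encode)).of_eq fun z => by
    cases z with
    | ofNat n =>
      have : Encodable.encode (n : ℤ) = 2 * n := rfl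
      simp [this]
    | negSucc n =>
      have : Encodable.encode (Int.negSucc n) = 2 * n + 1 := rfl
      simp [this]

theorem primrec_int_toNat_neg : Primrec fun z : ℤ => (-z).toNat :=
  (Primrec.cond (Primrec.nat_bodd.comp Primrec.encode)
    (Primrec.succ.comp (Primrec.nat_div2.comp Primrec.encode)) (Primrec.const 0)).of_eq fun z => by
    cases z with
    | ofNat n =>
      have : Encodable.encode (n : ℤ) = 2 * n := rfl
      simp [this]
    | negSucc n =>
      have : Encodable.encode (Int.negSucc n) = 2 * n + 1 := rfl
      simp [this]

end Primrec

/-- The next term of a sequence, given the coefficients of the recurrence and all previous terms. -/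
def nextTerm (as : List ℤ) (L : List ℕ) : ℕ :=
  ((List.range as.length).map fun j =>
      (as.getD j 0).toNat * L.getD (L.length - as.length + j) 0).sum -
    ((List.range as.length).map fun j =>
      (-as.getD j 0).toNat * L.getD (L.length - as.length + j) 0).sum

/-- The initial terms of a sequence, followed by `n` terms computed from the recurrence. -/
def termList (s : SequenceCode) (n : ℕ) : List ℕ :=
  n.rec s.2 fun _ L => L ++ [nextTerm s.1 L]

/-- The `n`-th term of the sequence described by `s`. -/
def seqTerm (s : SequenceCode) (n : ℕ) : ℕ :=
  (termList s n).getD n 0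

/-- Acceptance of a word by the automaton described by `D`. -/
def codeAccepts (D : DFACode) (w : List ℕ) : Bool :=
  D.2.2.getD (w.foldl (fun q d => (D.1.getD q []).getD d 0) D.2.1) false

/-- The list of all words of length `n` over the alphabet `{0, …, c - 1}`. -/
def wordsOfLength (c n : ℕ) : List (List ℕ) :=
  n.rec [[]] fun _ W => (List.range c).flatMap fun d => W.map fun w => d :: w

/-- The list of all words of length at least `T` and less than `2 * T`. -/
def testWords (c T : ℕ) : List (List ℕ) :=
  (List.range T).flatMap fun i => wordsOfLength c (T + i)

/-- The modulus with respect to which periodicity is tested. -/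
def codeModulus (s : SequenceCode) (m : ℕ) : ℕ :=
  m.factorial * ((s.1.length * seqTerm s (s.2.length + s.1.length)) ^ s.1.length).factorial

/-- The number of states of the product automaton. -/
def codeBound (x : SequenceCode × DFACode × DFACode) : ℕ :=
  x.2.1.1.length * codeModulus x.1 x.2.2.1.length ^ x.1.2.length * x.2.2.1.length

/-- Two words do not witness that the recognized set is not ultimately periodic. -/
def compatible (x : SequenceCode × DFACode × DFACode) (w w' : List ℕ) : Bool :=
  !(codeAccepts x.2.1 w && codeAccepts x.2.1 w' &&
    (decide (val (seqTerm x.1) w % codeModulus x.1 x.2.2.1.length =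
      val (seqTerm x.1) w' % codeModulus x.1 x.2.2.1.length)) &&
    codeAccepts x.2.2 w && !codeAccepts x.2.2 w')

/-- The decision procedure for ultimate periodicity. -/
def decideUltimatelyPeriodic (x : SequenceCode × DFACode × DFACode) : Bool :=
  (testWords (x.2.2.1.getD 0 []).length (codeBound x)).all fun w =>
    (testWords (x.2.2.1.getD 0 []).length (codeBound x)).all fun w' => compatible x w w'

theorem primrec_weightedSum {g : ℤ → ℕ} (hg : Primrec g) :
    Primrec₂ fun (as : List ℤ) (L : List ℕ) => ((List.range as.length).map fun j =>
      g (as.getD j 0) * L.getD (L.length - as.length + j) 0).sum := by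
  refine primrec_list_sum.comp (Primrec.list_map
    (Primrec.list_range.comp (Primrec.list_length.comp Primrec.fst)) ?_)
  refine Primrec.nat_mul.comp₂ (hg.comp₂ ((Primrec.list_getD 0).comp₂
    (Primrec.fst.comp₂ Primrec₂.left) Primrec₂.right)) ((Primrec.list_getD 0).comp₂
      (Primrec.snd.comp₂ Primrec₂.left) ?_)
  exact Primrec.nat_add.comp₂ (Primrec.nat_sub.comp₂
    ((Primrec.list_length.comp Primrec.snd).comp₂ Primrec₂.left)
    ((Primrec.list_length.comp Primrec.fst).comp₂ Primrec₂.left)) Primrec₂.right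

theorem primrec_nextTerm : Primrec₂ nextTerm :=
  Primrec.nat_sub.comp₂ (primrec_weightedSum primrec_int_toNat)
    (primrec_weightedSum primrec_int_toNat_neg)

theorem primrec_seqTerm : Primrec₂ seqTerm := by
  have h : Primrec₂ termList := Primrec.nat_rec (f := fun s : SequenceCode => s.2)
    (g := fun s p => p.2 ++ [nextTerm s.1 p.2]) Primrec.snd
    (Primrec.list_concat.comp₂ (Primrec.snd.comp₂ Primrec₂.right)
      (primrec_nextTerm.comp₂ (Primrec.fst.comp₂ Primrec₂.left) (Primrec.snd.comp₂ Primrec₂.right)))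
  exact (Primrec.list_getD 0).comp₂ h Primrec₂.right

theorem primrec_val_seqTerm : Primrec₂ fun s w => val (seqTerm s) w := by
  refine (Primrec.list_rec (f := fun p : SequenceCode × List ℕ => p.2) (g := fun _ => 0)
    (h := fun p q => q.1 * seqTerm p.1 q.2.1.length + q.2.2) Primrec.snd (Primrec.const 0)
    ?_).of_eq fun p => ?_
  · exact Primrec.nat_add.comp₂ (Primrec.nat_mul.comp₂ (Primrec.fst.comp₂ Primrec₂.right)
      (primrec_seqTerm.comp₂ (Primrec.fst.comp₂ Primrec₂.left)
        ((Primrec.list_length.comp (Primrec.fst.comp Primrec.snd)).comp₂ Primrec₂.right)))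
      ((Primrec.snd.comp Primrec.snd).comp₂ Primrec₂.right)
  · obtain ⟨s, w⟩ := p
    induction w with
    | nil => rfl
    | cons d w ih =>
      simp only [val] at ih ⊢
      rw [ih]

theorem primrec_codeAccepts : Primrec₂ codeAccepts := by
  refine (Primrec.list_getD false).comp₂ ((Primrec.snd.comp Primrec.snd).comp₂ Primrec₂.left)
    (Primrec.list_foldl (f := fun p : DFACode × List ℕ => p.2) (g := fun p => p.1.2.1)
      (h := fun p q => (p.1.1.getD q.1 []).getD q.2 0) Primrec.snd
      (Primrec.fst.comp (Primrec.snd.comp Primrec.fst)) ?_)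
  exact (Primrec.list_getD 0).comp₂ ((Primrec.list_getD []).comp₂
    ((Primrec.fst.comp Primrec.fst).comp₂ Primrec₂.left) (Primrec.fst.comp₂ Primrec₂.right))
    (Primrec.snd.comp₂ Primrec₂.right)

theorem primrec_testWords : Primrec₂ testWords := by
  have hstep : Primrec₂ fun (c : ℕ) (p : ℕ × List (List ℕ)) =>
      (List.range c).flatMap fun d => p.2.map fun w => d :: w := by
    refine Primrec.list_flatMap (Primrec.list_range.comp Primrec.fst) ?_
    refine Primrec.list_map (Primrec.snd.comp (Primrec.snd.comp Primrec.fst)) ?_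
    exact Primrec.list_cons.comp₂ (Primrec.snd.comp₂ Primrec₂.left) Primrec₂.right
  have h : Primrec₂ wordsOfLength := Primrec.nat_rec (f := fun _ : ℕ => [[]])
    (g := fun c p => (List.range c).flatMap fun d => p.2.map fun w => d :: w)
    (Primrec.const [[]]) hstep
  refine Primrec.list_flatMap (Primrec.list_range.comp Primrec.snd) ?_
  exact h.comp₂ (Primrec.fst.comp₂ Primrec₂.left)
    (Primrec.nat_add.comp₂ (Primrec.snd.comp₂ Primrec₂.left) Primrec₂.right)

theorem primrec_codeModulus : Primrec₂ codeModulus := by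
  have hk : Primrec fun p : SequenceCode × ℕ => p.1.1.length :=
    Primrec.list_length.comp (Primrec.fst.comp Primrec.fst)
  have hn : Primrec fun p : SequenceCode × ℕ => p.1.2.length :=
    Primrec.list_length.comp (Primrec.snd.comp Primrec.fst)
  exact Primrec.nat_mul.comp (primrec_factorial.comp Primrec.snd)
    (primrec_factorial.comp (primrec_pow.comp (Primrec.nat_mul.comp hk
      (primrec_seqTerm.comp Primrec.fst (Primrec.nat_add.comp hn hk))) hk))

theorem primrec_card {f : SequenceCode × DFACode × DFACode → DFACode} (hf : Primrec f) :
    Primrec fun x => (f x).1.length :=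
  Primrec.list_length.comp (Primrec.fst.comp hf)

theorem primrec_codeModulus_input :
    Primrec fun x : SequenceCode × DFACode × DFACode => codeModulus x.1 x.2.2.1.length :=
  primrec_codeModulus.comp Primrec.fst (primrec_card (Primrec.snd.comp Primrec.snd))

theorem primrec_codeBound : Primrec codeBound :=
  Primrec.nat_mul.comp (Primrec.nat_mul.comp (primrec_card (Primrec.fst.comp Primrec.snd))
    (primrec_pow.comp primrec_codeModulus_input
      (Primrec.list_length.comp (Primrec.snd.comp Primrec.fst))))
    (primrec_card (Primrec.snd.comp Primrec.snd))

theorem primrec_compatible :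
    Primrec fun p : (SequenceCode × DFACode × DFACode) × List ℕ × List ℕ =>
      compatible p.1 p.2.1 p.2.2 := by
  have hw : Primrec fun p : (SequenceCode × DFACode × DFACode) × List ℕ × List ℕ => p.2.1 :=
    Primrec.fst.comp Primrec.snd
  have hw' : Primrec fun p : (SequenceCode × DFACode × DFACode) × List ℕ × List ℕ => p.2.2 :=
    Primrec.snd.comp Primrec.snd
  have hB : Primrec fun p : (SequenceCode × DFACode × DFACode) × List ℕ × List ℕ => p.1.2.1 :=
    Primrec.fst.comp (Primrec.snd.comp Primrec.fst)
  have hA : Primrec fun p : (SequenceCode × DFACode × DFACode) × List ℕ × List ℕ => p.1.2.2 :=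
    Primrec.snd.comp (Primrec.snd.comp Primrec.fst)
  have hs : Primrec fun p : (SequenceCode × DFACode × DFACode) × List ℕ × List ℕ => p.1.1 :=
    Primrec.fst.comp Primrec.fst
  have hQ := primrec_codeModulus_input.comp
    (Primrec.fst : Primrec fun p : (SequenceCode × DFACode × DFACode) × List ℕ × List ℕ => p.1)
  have hmod := Primrec.eq.decide.comp
    (Primrec.nat_mod.comp (primrec_val_seqTerm.comp hs hw) hQ)
    (Primrec.nat_mod.comp (primrec_val_seqTerm.comp hs hw') hQ)
  exact Primrec.not.comp (Primrec.and.comp (Primrec.and.comp (Primrec.and.comp (Primrec.and.comp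
    (primrec_codeAccepts.comp hB hw) (primrec_codeAccepts.comp hB hw')) hmod)
    (primrec_codeAccepts.comp hA hw)) (Primrec.not.comp (primrec_codeAccepts.comp hA hw')))

theorem primrec_decideUltimatelyPeriodic : Primrec decideUltimatelyPeriodic := by
  have hwords : Primrec fun x : SequenceCode × DFACode × DFACode =>
      testWords (x.2.2.1.getD 0 []).length (codeBound x) :=
    primrec_testWords.comp (Primrec.list_length.comp ((Primrec.list_getD []).comp
      (Primrec.fst.comp (Primrec.snd.comp Primrec.snd)) (Primrec.const 0))) primrec_codeBound
  have hinner : Primrec₂ fun (p : (SequenceCode × DFACode × DFACode) × List ℕ) (w' : List ℕ) =>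
      compatible p.1 p.2 w' :=
    primrec_compatible.comp (g := fun q : ((SequenceCode × DFACode × DFACode) × List ℕ) × List ℕ =>
      (q.1.1, q.1.2, q.2)) (Primrec.pair (Primrec.fst.comp Primrec.fst)
        (Primrec.pair (Primrec.snd.comp Primrec.fst) Primrec.snd))
  have houter : Primrec₂ fun (x : SequenceCode × DFACode × DFACode) (w : List ℕ) =>
      (testWords (x.2.2.1.getD 0 []).length (codeBound x)).all fun w' => compatible x w w' :=
    primrec_list_all (hwords.comp Primrec.fst) hinner
  exact primrec_list_all hwords houter

/-! ### Correctness of the procedure on encoded inputs -/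

section Sequence

variable {U : ℕ → ℕ} {k : ℕ} {a : Fin k → ℤ} {N : ℕ}

theorem nextTerm_eq (hrec : IsRecurrence U k a N) (n : ℕ) :
    nextTerm (List.ofFn a) ((List.range (N + k + n)).map U) = U (N + k + n) := by
  have hsum : ∀ g : ℤ → ℕ, ((List.range (List.ofFn a).length).map fun j =>
      g ((List.ofFn a).getD j 0) * ((List.range (N + k + n)).map U).getD
        (((List.range (N + k + n)).map U).length - (List.ofFn a).length + j) 0).sum =
      ∑ j : Fin k, g (a j) * U (N + n + j) := by
    intro g
    rw [List.length_ofFn, List.length_map, List.length_range, ← List.sum_ofFn]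
    congr 1
    refine List.ext_getElem (by simp) fun j h1 h2 => ?_
    have hj : j < k := by simpa using h1
    have hidx : N + k + n - k + j = N + n + j := by omega
    simp [hidx, hj, show N + n + j < N + k + n by omega]
  rw [nextTerm, hsum, hsum fun z => (-z).toNat]
  have h := hrec.relation (N + n) (by omega)
  rw [show N + n + k = N + k + n by omega] at h
  -- Positive and negative parts of the coefficients are summed apart; their difference is a term of
  -- U, so the truncated subtraction is exact.
  have h' : ((∑ j : Fin k, (a j).toNat * U (N + n + j) : ℕ) : ℤ) =
      (∑ j : Fin k, (-a j).toNat * U (N + n + j) : ℕ) + U (N + k + n) := by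
    rw [h]
    push_cast
    rw [← Finset.sum_add_distrib]
    refine Finset.sum_congr rfl fun j _ => ?_
    rw [← add_mul]
    congr 1
    omega
  omega

theorem termList_encodeSequence (hrec : IsRecurrence U k a N) (n : ℕ) :
    termList (encodeSequence U k a N) n = (List.range (N + k + n)).map U := by
  induction n with
  | zero =>
    exact List.ext_getElem (by simp [termList, encodeSequence])
      (fun i _ _ => by simp [termList, encodeSequence])
  | succ n ih =>
    change termList (encodeSequence U k a N) n ++
      [nextTerm (List.ofFn a) (termList (encodeSequence U k a N) n)] = _
    rw [ih, nextTerm_eq hrec, ← add_assoc, List.range_succ, List.map_append]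
    rfl

theorem seqTerm_encodeSequence (hrec : IsRecurrence U k a N) :
    seqTerm (encodeSequence U k a N) = U := by
  funext n
  have := hrec.pos
  rw [seqTerm, termList_encodeSequence hrec]
  -- As k ≥ 1, the list already contains index `n` and the default 0 is never read.
  simp [show n < N + k + n by omega]

theorem codeModulus_encodeSequence (hrec : IsRecurrence U k a N) (m : ℕ) :
    codeModulus (encodeSequence U k a N) m = periodMultiple U k N m := by
  rw [codeModulus, seqTerm_encodeSequence hrec, periodMultiple]
  simp [encodeSequence, two_mul, add_assoc]

end Sequence

theorem encodeDFA_length {c n : ℕ} (M : DFA (Fin c) (Fin n)) : (encodeDFA M).1.length = n := by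
  simp [encodeDFA]

theorem encodeDFA_row_length {c n : ℕ} (M : DFA (Fin c) (Fin n)) :
    ((encodeDFA M).1.getD 0 []).length = c := by
  -- The initial state guarantees a row 0, from which the alphabet size is read off.
  have : 0 < n := Fin.pos M.start
  simp [encodeDFA, this]

theorem codeAccepts_encodeDFA {c n : ℕ} (M : DFA (Fin c) (Fin n)) (w : List (Fin c)) :
    codeAccepts (encodeDFA M) (w.map Fin.val) = true ↔ w ∈ M.accepts := by
  have h : ∀ q : Fin n, (w.map Fin.val).foldl
      (fun q d => ((encodeDFA M).1.getD q []).getD d 0) (q : ℕ) = (M.evalFrom q w : ℕ) := by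
    induction w with
    | nil => exact fun q => rfl
    | cons d w ih =>
      intro q
      rw [List.map_cons, List.foldl_cons, DFA.evalFrom_cons, ← ih]
      congr 1
      simp [encodeDFA]
  rw [DFA.mem_accepts, codeAccepts]
  change ((encodeDFA M).2.2.getD (List.foldl _ (M.start : ℕ) _) false) = true ↔ _
  rw [h]
  simp [encodeDFA, DFA.eval]

theorem mem_wordsOfLength {c n : ℕ} {w : List ℕ} :
    w ∈ wordsOfLength c n ↔ ∃ v : List (Fin c), v.length = n ∧ v.map Fin.val = w := by
  induction n generalizing w with
  | zero =>
    change w ∈ [[]] ↔ _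
    simp [eq_comm]
  | succ n ih =>
    change w ∈ (List.range c).flatMap (fun d => (wordsOfLength c n).map fun w => d :: w) ↔ _
    simp only [List.mem_flatMap, List.mem_range, List.mem_map, ih]
    constructor
    · rintro ⟨d, hd, _, ⟨v, hv, rfl⟩, rfl⟩
      exact ⟨⟨d, hd⟩ :: v, by simp [hv], rfl⟩
    · rintro ⟨v, hv, rfl⟩
      cases v with
      | nil => simp at hv
      | cons d v => exact ⟨d, d.2, _, ⟨v, by simpa using hv, rfl⟩, rfl⟩

theorem mem_testWords {c T : ℕ} {w : List ℕ} :
    w ∈ testWords c T ↔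
      ∃ v : List (Fin c), T ≤ v.length ∧ v.length < 2 * T ∧ v.map Fin.val = w := by
  simp only [testWords, List.mem_flatMap, List.mem_range, mem_wordsOfLength]
  constructor
  · rintro ⟨i, hi, v, hv, rfl⟩
    exact ⟨v, by omega, by omega, rfl⟩
  · rintro ⟨v, h1, h2, rfl⟩
    exact ⟨v.length - T, by omega, v, by omega, rfl⟩

theorem compatible_encode {U : ℕ → ℕ} {k N : ℕ} {a : Fin k → ℤ} (hrec : IsRecurrence U k a N)
    {c b m : ℕ} (B : DFA (Fin c) (Fin b)) (A : DFA (Fin c) (Fin m)) (w w' : List (Fin c)) :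
    compatible (encodeSequence U k a N, encodeDFA B, encodeDFA A) (w.map Fin.val)
        (w'.map Fin.val) = true ↔
      (w ∈ B.accepts → w' ∈ B.accepts →
        val U (w.map Fin.val) ≡ val U (w'.map Fin.val) [MOD periodMultiple U k N m] →
        w ∈ A.accepts → w' ∈ A.accepts) := by
  simp only [compatible, encodeDFA_length, codeModulus_encodeSequence hrec,
    seqTerm_encodeSequence hrec, ← codeAccepts_encodeDFA, Nat.ModEq]
  generalize codeAccepts (encodeDFA B) _ = x₁
  generalize codeAccepts (encodeDFA B) _ = x₂
  generalize codeAccepts (encodeDFA A) _ = x₃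
  generalize codeAccepts (encodeDFA A) _ = x₄
  cases x₁ <;> cases x₂ <;> cases x₃ <;> cases x₄ <;> simp

theorem decideUltimatelyPeriodic_iff {U : ℕ → ℕ} (hU : IsNumerationSystem U) {k N : ℕ}
    {a : Fin k → ℤ} (hrec : IsMinimalRecurrence U k a N) (hgcd : Finset.univ.gcd a = 1)
    (h2 : H2 U) (h3 : H3 U) {b m : ℕ} (B : DFA (Fin (alphabetSize U)) (Fin b))
    (A : DFA (Fin (alphabetSize U)) (Fin m)) (hB : B.accepts = repLanguage U Set.univ) :
    decideUltimatelyPeriodic (encodeSequence U k a N, encodeDFA B, encodeDFA A) = true ↔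
      UltimatelyPeriodic (recognizedSet U A.accepts) := by
  have hrec' := hrec.toIsRecurrence
  have hlen : (encodeSequence U k a N).2.length = N + k := by simp [encodeSequence]
  rw [ultimatelyPeriodic_iff hU hrec hgcd h2 h3,
    isUltimatePeriod_iff hU hrec' (periodMultiple_pos U k N m) B A hB rfl]
  simp only [decideUltimatelyPeriodic, codeBound, encodeDFA_length, hlen, encodeDFA_row_length,
    codeModulus_encodeSequence hrec', List.all_eq_true, mem_testWords]
  constructor
  · intro h w hw w' hw' hl1 hl2 hl1' hl2'
    exact (compatible_encode hrec' B A w w').1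
      (h _ ⟨w, hl1, hl2, rfl⟩ _ ⟨w', hl1', hl2', rfl⟩) hw hw'
  · rintro h _ ⟨w, hl1, hl2, rfl⟩ _ ⟨w', hl1', hl2', rfl⟩
    exact (compatible_encode hrec' B A w w').2 fun hw hw' => h w hw w' hw' hl1 hl2 hl1' hl2'

end NumerationSystem

open NumerationSystem in
theorem mainTheorem1 :
    (∃ f : SequenceCode × DFACode × DFACode →. Bool, Partrec f ∧
      ∀ (U : ℕ → ℕ) (k : ℕ) (a : Fin k → ℤ) (N : ℕ),
        IsNumerationSystem U → IsMinimalRecurrence U k a N → Finset.univ.gcd a = 1 →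
        H1 U → H2 U → H3 U →
        ∀ (b : ℕ) (B : DFA (Fin (alphabetSize U)) (Fin b)),
          B.accepts = repLanguage U Set.univ →
        ∀ (m : ℕ) (A : DFA (Fin (alphabetSize U)) (Fin m)),
          A.accepts ≤ repLanguage U Set.univ →
          ∃ r ∈ f (encodeSequence U k a N, encodeDFA B, encodeDFA A),
            (r = true ↔ UltimatelyPeriodic (recognizedSet U A.accepts))) ∧
    (∀ (U : ℕ → ℕ) (k : ℕ) (a : Fin k → ℤ) (N : ℕ),
      IsNumerationSystem U → ∀ hrec : IsMinimalRecurrence U k a N, Finset.univ.gcd a = 1 →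
      H1 U → H2 U → H3 U →
      ∀ p : ℕ, p.Prime →
        ∃ l : ℕ, 1 ≤ l ∧ (|a ⟨0, hrec.pos⟩| < p → U N < p → l = 1) ∧
          ∀ (m : ℕ) (A : DFA (Fin (alphabetSize U)) (Fin m)),
            A.accepts ≤ repLanguage U Set.univ →
            UltimatelyPeriodic (recognizedSet U A.accepts) →
            ∀ e ≥ l, p ^ e ∣ period (recognizedSet U A.accepts) → p ^ (e - l + 1) ≤ m) := by
  refine ⟨⟨fun x => Part.some (decideUltimatelyPeriodic x),
    primrec_decideUltimatelyPeriodic.to_comp.partrec, ?_⟩, ?_⟩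
  · intro U k a N hU hrec hgcd _ h2 h3 b B hB m A _
    exact ⟨_, Part.mem_some _, decideUltimatelyPeriodic_iff hU hrec hgcd h2 h3 B A hB⟩
  · intro U k a N hU hrec hgcd _ h2 h3 p hp
    obtain ⟨l, hl, hl1, h⟩ := exists_period_exponent hU hrec hgcd h2 h3 hp
    exact ⟨l, hl, hl1, fun m A _ => h m A⟩
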